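/- Let $A\subseteq\mathbb{Q}$ be any subset, and let $\mathbb{V}$ be the infinite strip $\mathbb{R}\times[0,1]$ with vertices $(i,0)$, $i\in\mathbb{Z}$, on the lower boundary, vertices $(q,1)$, $q\in A$, on the upper boundary, and two limit points $-\infty$ and $+\infty$ at the left and right ends of the strip. Arcs are isotopy classes of curves in $\mathbb{V}$ joining two distinct points among the vertices and the two limit points (arcs to a limit point are asymptotic arcs; the one joining the two limit points is the generic arc); segments of the upper or lower boundary between neighbouring vertices are not counted as arcs. Two arcs are compatible if they have representatives that do not cross. A triangulation $T$ of $\mathbb{V}$ is a maximal collection of pairwise compatible arcs, and it is admissible if every lower vertex $(i,0)$ is incident with only finitely many arcs of $T$. The triangles of $T$ are those whose sides are arcs of $T$ or boundary segments; limit points are allowed as corners. For $i\le j$, let $\mathcal{M}_{ij}$ be the set of matchings between the vertices $(i,0),(i+1,0),\dots,(j,0)$ and the triangles of $T$, that is, of assignments to each of these vertices of a triangle of $T$ incident with it, such that distinct vertices receive distinct triangles. An infinite frieze is an array of integers $(m_{ij})_{i,j\in\mathbb{Z},\,j\ge i-2}$ with $m_{i,i-2}=0$, $m_{i,i-1}=1$,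 $m_{ij}>0$ for $i\le j$, and $m_{ij}m_{i+1,j+1}-m_{i+1,j}m_{i,j+1}=1$ for all $j\ge i-1$; its quiddity row is $(m_{ii})_{i\in\mathbb{Z}}$. **Theorem.** Let $T$ be an admissible triangulation of $\mathbb{V}$ and, for every $i\in\mathbb{Z}$, let $a_i$ be the number of triangles of $T$ incident with $(i,0)$. Then the $a_i$ and all $|\mathcal{M}_{ij}|$ ($i\le j$) are finite, $(a_i)_{i\in\mathbb{Z}}$ is the quiddity row of an infinite frieze $\mathcal{F}=(m_{ij})_{i,j}$, and $m_{ij}=|\mathcal{M}_{ij}|$ for all $i\le j$ (for every infinite frieze $\mathcal{F}$ with this quiddity row). -/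

import Mathlib

namespace InfiniteStrip

/-- The points at which arcs of the strip `ℝ × [0,1]` may end: the vertices `(i, 0)`, `i ∈ ℤ`, on the
lower boundary, the vertices `(q, 1)`, `q ∈ A ⊆ ℚ`, on the upper boundary, and the two limit
points at the left and right extremities of the strip. -/
inductive Pt (A : Set ℚ) : Type
  | lower (i : ℤ) : Pt A
  | upper (q : A) : Pt A
  | negInf : Pt A
  | posInf : Pt A

namespace Pt

/-- The strip together with its two limit points is a disc, with all points of `Pt A` on its
boundary circle. `x.Before y` means that `x` is met before `y` when one runs once around this circle
anticlockwise, starting at `-∞`: first along the lower boundary from left to right, then through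
`+∞`, then along the upper boundary from right to left. -/
def Before {A : Set ℚ} : Pt A → Pt A → Prop
  | negInf, negInf => False
  | negInf, _ => True
  | lower _, negInf => False
  | lower i, lower j => i < j
  | lower _, posInf => True
  | lower _, upper _ => True
  | posInf, upper _ => True
  | posInf, _ => False
  | upper p, upper q => (q : ℚ) < p
  | upper _, _ => False

end Pt

variable {A : Set ℚ}

/-- The boundary segments: `e` joins two neighbouring vertices of the lower boundary, or two
neighbouring vertices of the upper boundary. -/
def IsBoundarySegment (e : Sym2 (Pt A)) : Prop :=
  (∃ i : ℤ, e = s(Pt.lower i, Pt.lower (i + 1))) ∨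
  (∃ p q : A, (p : ℚ) < q ∧ (∀ r ∈ A, ¬ ((p : ℚ) < r ∧ r < q)) ∧ e = s(Pt.upper p, Pt.upper q))

/-- Arcs. As the strip is simply connected with all marked points on its boundary, an isotopy class of
curves is given by its two distinct end points; the classes of the boundary segments are not arcs.
So there are bridging arcs (`lower`-`upper`), peripheral arcs (`lower`-`lower`, `upper`-`upper`),
asymptotic arcs (a vertex and a limit point) and the generic arc (the two limit points). -/
def IsArc (e : Sym2 (Pt A)) : Prop :=
  ¬ e.IsDiag ∧ ¬ IsBoundarySegment e

/-- `e` and `f` cross: their end points are four distinct points which alternate along the boundary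
circle. -/
def Crosses (e f : Sym2 (Pt A)) : Prop :=
  ∃ a b c d : Pt A, a.Before b ∧ b.Before c ∧ c.Before d ∧
    ((e = s(a, c) ∧ f = s(b, d)) ∨ (e = s(b, d) ∧ f = s(a, c)))

/-- Two arcs are compatible if they have representatives that do not meet outside their end points. -/
def Compatible (e f : Sym2 (Pt A)) : Prop :=
  ¬ Crosses e f

/-- A collection of pairwise compatible arcs. -/
def IsCompatibleCollection (T : Set (Sym2 (Pt A))) : Prop :=
  (∀ e ∈ T, IsArc e) ∧ T.Pairwise Compatible

/-- A triangulation of the strip: a maximal collection of pairwise compatible arcs. -/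
def IsTriangulation (T : Set (Sym2 (Pt A))) : Prop :=
  Maximal IsCompatibleCollection T

/-- An admissible triangulation: every lower vertex is incident with only finitely many arcs. -/
def IsAdmissibleTriangulation (T : Set (Sym2 (Pt A))) : Prop :=
  IsTriangulation T ∧ ∀ i : ℤ, {e ∈ T | Pt.lower i ∈ e}.Finite

/-- The triangles of `T`, given by their corners: three points, any two of which are joined by an arc
of `T` or by a boundary segment. (No arc of `T` can run through the interior of such a triangle,
because it would cross one of the sides.) -/
def IsTriangle (T : Set (Sym2 (Pt A))) (t : Finset (Pt A)) : Prop :=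
  t.card = 3 ∧ ∀ x ∈ t, ∀ y ∈ t, x ≠ y → (s(x, y) ∈ T ∨ IsBoundarySegment s(x, y))

/-- The set of triangles of `T` incident with the lower vertex `(i, 0)`. -/
def trianglesAt (T : Set (Sym2 (Pt A))) (i : ℤ) : Set (Finset (Pt A)) :=
  {t | IsTriangle T t ∧ Pt.lower i ∈ t}

/-- The set of matchings between the vertices `(i, 0), …, (j, 0)` and the triangles of `T`: each of
these vertices is assigned a triangle incident with it, distinct vertices being assigned distinct
triangles. -/
def matchings (T : Set (Sym2 (Pt A))) (i j : ℤ) : Set (Set.Icc i j → Finset (Pt A)) :=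
  {f | Function.Injective f ∧ ∀ k : Set.Icc i j, f k ∈ trianglesAt T k}

/-- Infinite friezes of positive integers. Only the entries `m i j` with `i - 2 ≤ j` belong to the
array. -/
def IsInfiniteFrieze (m : ℤ → ℤ → ℤ) : Prop :=
  (∀ i, m i (i - 2) = 0) ∧ (∀ i, m i (i - 1) = 1) ∧ (∀ i j, i ≤ j → 0 < m i j) ∧
  (∀ i j, i - 1 ≤ j → m i j * m (i + 1) (j + 1) - m (i + 1) j * m i (j + 1) = 1)

/-- `a` is the quiddity row (first non-trivial row) of the array `m`. -/
def IsQuiddityRow (m : ℤ → ℤ → ℤ) (a : ℤ → ℤ) : Prop :=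
  ∀ i, m i i = a i

end InfiniteStrip

/-!
Let `N` be the incidence matrix between the lower vertices `(i, 0), …, (j, 0)` and the triangles of
`T`, with the entry of each vertex that is the middle corner of a triangle (the boundary circle
being cut open at `-∞`) negated. Every lower vertex is incident with finitely many triangles, two
consecutive ones have one triangle in common, lying above the boundary segment between them, and two
others have in common either none or the two triangles on the two sides of an arc. The signs make
the contributions of these two cancel, so `N * Nᵀ` is tridiagonal with the `a_k` on the diagonal and
`-1` next to it, and its determinant is the continuant of `a_i, …, a_j`. On the other hand, as in
the Cauchy–Binet formula, this determinant is the sum of the squares of the maximal minors of `N`.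
A matching is determined by the set of triangles it uses, so such a minor is `± 1` if its columns
are the triangles of a matching and `0` otherwise. Hence the continuants count matchings. They
are positive, since each vertex can be matched with a triangle of which it is the middle corner, and
so they are the entries of the only infinite frieze with quiddity row `(a_k)`.
-/

namespace InfiniteStrip

/-! ### Continuants and friezes -/

section Continuant

variable {R : Type*} [CommRing R]

/-- The tridiagonal matrix with diagonal `a i, a (i + 1), …, a (i + n - 1)` and all entries next to
the diagonal equal to `-1`. -/
def tridiagonal (a : ℤ → R) (i : ℤ) (n : ℕ) : Matrix (Fin n) (Fin n) R :=
  .of fun p q ↦ if p = q then a (i + p) else if (p : ℕ) + 1 = q ∨ (q : ℕ) + 1 = p then -1 else 0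

/-- The (signed) continuant of the `n` consecutive terms of `a` starting with `a i`. -/
def continuant (a : ℤ → R) (i : ℤ) (n : ℕ) : R :=
  (tridiagonal a i n).det

theorem tridiagonal_submatrix_succ (a : ℤ → R) (i : ℤ) (n : ℕ) :
    (tridiagonal a i (n + 1)).submatrix Fin.succ Fin.succ = tridiagonal a (i + 1) n := by
  ext p q
  simp [tridiagonal, add_assoc, add_comm (1 : ℤ)]

@[simp]
theorem continuant_zero (a : ℤ → R) (i : ℤ) : continuant a i 0 = 1 :=
  Matrix.det_isEmpty

@[simp]
theorem continuant_one (a : ℤ → R) (i : ℤ) : continuant a i 1 = a i := by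
  simp [continuant, tridiagonal]

theorem continuant_add_two (a : ℤ → R) (i : ℤ) (n : ℕ) :
    continuant a i (n + 2) = a i * continuant a (i + 1) (n + 1) - continuant a (i + 2) n := by
  have hminor : ((tridiagonal a i (n + 2)).submatrix Fin.succ (Fin.succAbove 1)).det =
      -continuant a (i + 2) n := by
    have hsub : ((tridiagonal a i (n + 2)).submatrix Fin.succ (Fin.succAbove 1)).submatrix
        Fin.succ Fin.succ = tridiagonal a (i + 2) n := by
      rw [show i + 2 = i + 1 + 1 by ring, ← tridiagonal_submatrix_succ,
        ← tridiagonal_submatrix_succ]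
      ext p q
      simp
    rw [Matrix.det_succ_column_zero, Fin.sum_univ_succ, Finset.sum_eq_zero]
    · simp only [Fin.succAbove_zero, hsub]
      simp [tridiagonal, continuant]
    · intro p _
      simp [tridiagonal]
  have hdiag : tridiagonal a i (n + 2) 0 0 = a i := by simp [tridiagonal]
  have hoff : tridiagonal a i (n + 2) 0 1 = -1 := by simp [tridiagonal]
  rw [continuant, Matrix.det_succ_row_zero, Fin.sum_univ_succ, Fin.sum_univ_succ,
    Finset.sum_eq_zero]
  · rw [Fin.succAbove_zero, tridiagonal_submatrix_succ, Fin.succ_zero_eq_one, hminor]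
    simp only [hdiag, hoff, Fin.val_zero, Fin.val_one, pow_zero, pow_one, continuant]
    ring
  · intro p _
    simp [tridiagonal, Fin.ext_iff]

theorem continuant_mul_sub_mul (a : ℤ → R) (i : ℤ) (n : ℕ) :
    continuant a i (n + 1) * continuant a (i + 1) (n + 1) -
      continuant a (i + 1) n * continuant a i (n + 2) = 1 := by
  induction n generalizing i with
  | zero =>
    simp only [zero_add, continuant_add_two, continuant_zero, continuant_one]
    ring
  | succ n ih =>
    have h := ih (i + 1)
    rw [add_assoc i 1 1, one_add_one_eq_two] at h
    rw [continuant_add_two a i (n + 1), continuant_add_two a i n]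
    linear_combination h

/-- The frieze pattern with quiddity row `a`: its entry in position `(i, j)` is the continuant of
`a i, …, a j`, which is `1` on the row `j = i - 1`; a row of zeros is put below. -/
def continuantArray (a : ℤ → ℤ) (i j : ℤ) : ℤ :=
  if i - 1 ≤ j then continuant a i (j - (i - 1)).toNat else 0

theorem continuantArray_eq_continuant (a : ℤ → ℤ) {i j : ℤ} {n : ℕ} (h : i - 1 + n = j) :
    continuantArray a i j = continuant a i n := by
  rw [continuantArray, if_pos (by lia), show (j - (i - 1)).toNat = n by lia]

theorem isQuiddityRow_continuantArray (a : ℤ → ℤ) : IsQuiddityRow (continuantArray a) a := fun i ↦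
  (continuantArray_eq_continuant a (n := 1) (by simp)).trans (continuant_one a i)

theorem isInfiniteFrieze_continuantArray {a : ℤ → ℤ} (hpos : ∀ i n, 0 < continuant a i n) :
    IsInfiniteFrieze (continuantArray a) := by
  refine ⟨fun i ↦ if_neg (by lia), fun i ↦ ?_, fun i j hij ↦ ?_, fun i j hij ↦ ?_⟩
  · rw [continuantArray_eq_continuant a (n := 0) (by simp), continuant_zero]
  · rw [continuantArray, if_pos (by lia)]
    exact hpos _ _
  obtain ⟨n, rfl⟩ := Int.le.dest hij
  rw [continuantArray_eq_continuant a (i := i) (n := n) rfl,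
    continuantArray_eq_continuant a (i := i + 1) (n := n) (by ring),
    continuantArray_eq_continuant a (i := i) (n := n + 1) (by push_cast; ring)]
  cases n with
  | zero =>
    rw [continuantArray, if_neg (by lia)]
    simp
  | succ n =>
    rw [continuantArray_eq_continuant a (i := i + 1) (n := n) (by push_cast; ring)]
    exact continuant_mul_sub_mul a i n

/-- The unimodular rule determines the entry `m i (j + 1)` because its coefficient `m (i + 1) j`
is positive. -/
theorem IsInfiniteFrieze.eq_continuant {m : ℤ → ℤ → ℤ} {a : ℤ → ℤ} (hm : IsInfiniteFrieze m)
    (hq : IsQuiddityRow m a) (i : ℤ) (n : ℕ) : m i (i - 1 + n) = continuant a i n := by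
  obtain ⟨-, hone, hpos, hrule⟩ := hm
  induction n using Nat.twoStepInduction generalizing i with
  | zero => simpa using hone i
  | one => simpa using hq i
  | more n ih₀ ih₁ =>
    have hrule := hrule i (i + n) (by lia)
    have e₀ := ih₀ (i + 1)
    have e₁ := ih₁ i
    have e₂ := ih₁ (i + 1)
    have hne : m (i + 1) (i + n) ≠ 0 := by
      rcases n.eq_zero_or_pos with rfl | hn
      · have := hone (i + 1)
        simp_all
      · exact (hpos _ _ (by lia)).ne'
    push_cast at e₁ e₂ ⊢
    rw [show i + 1 - 1 + n = i + n by ring] at e₀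
    rw [show i - 1 + (n + 1) = i + (n : ℤ) by ring] at e₁
    rw [show i + 1 - 1 + (n + 1) = i + n + 1 by ring] at e₂
    rw [show i - 1 + (n + 2) = i + (n : ℤ) + 1 by ring]
    have hcont := continuant_mul_sub_mul a i n
    rw [← e₀, ← e₁, ← e₂] at hcont
    exact mul_left_cancel₀ hne (by linarith)

end Continuant

/-! ### Gram determinants -/

section Gram

variable {R ι τ : Type*} [CommRing R] [Fintype ι] [DecidableEq ι]

theorem det_gram_eq_sum (N : ι → τ → R) (F : ι → Finset τ) :
    (Matrix.of fun k l ↦ ∑ t ∈ F k, N k t * N l t).det =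
      ∑ f ∈ Fintype.piFinset F, (∏ k, N k (f k)) * (Matrix.of fun k l ↦ N l (f k)).det := by
  have hrows : (Matrix.of fun k l ↦ ∑ t ∈ F k, N k t * N l t) =
      fun k ↦ ∑ t ∈ F k, N k t • fun l ↦ N l t := by
    ext k l
    simp
  rw [hrows]
  change Matrix.detRowAlternating.toMultilinearMap _ = _
  rw [MultilinearMap.map_sum_finset]
  exact Finset.sum_congr rfl fun f _ ↦ MultilinearMap.map_smul_univ _ _ _

/-- In the expansion by multilinearity in the rows, the choices with a repetition vanish and, by
`huniq`, each of the others contributes the square of a product of signs. -/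
theorem det_gram_eq_card_injective [DecidableEq τ] (N : ι → τ → R) (F : ι → Finset τ)
    (hsq : ∀ k, ∀ t ∈ F k, N k t * N k t = 1) (hzero : ∀ k l, ∀ t ∈ F k, t ∉ F l → N l t = 0)
    (huniq : ∀ f : ι → τ, Function.Injective f → (∀ k, f k ∈ F k) →
      ∀ σ : Equiv.Perm ι, (∀ k, f (σ k) ∈ F k) → σ = 1) :
    (Matrix.of fun k l ↦ ∑ t ∈ F k, N k t * N l t).det =
      (({f ∈ Fintype.piFinset F | Function.Injective f} : Finset (ι → τ)).card : R) := by
  rw [det_gram_eq_sum, Finset.card_filter, Nat.cast_sum]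
  refine Finset.sum_congr rfl fun f hf ↦ ?_
  rw [Fintype.mem_piFinset] at hf
  split_ifs with hinj
  · have hdiag : (Matrix.of fun k l ↦ N l (f k)).det = ∏ k, N k (f k) := by
      rw [Matrix.det_apply, Finset.sum_eq_single_of_mem 1 (Finset.mem_univ 1)]
      · simp
      · intro σ _ hσ
        obtain ⟨k, hk⟩ := not_forall.1 (mt (huniq f hinj hf σ) hσ)
        rw [Finset.prod_eq_zero (Finset.mem_univ k) (hzero _ k _ (hf (σ k)) hk), smul_zero]
    rw [hdiag, ← Finset.prod_mul_distrib, Finset.prod_eq_one fun k _ ↦ hsq k _ (hf k),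
      Nat.cast_one]
  · obtain ⟨k, l, hkl, hne⟩ := Function.not_injective_iff.1 hinj
    rw [Matrix.det_zero_of_row_eq hne (by ext; simp [hkl]), mul_zero, Nat.cast_zero]

end Gram

/-! ### The boundary circle -/

theorem exists_last_of_finite {α : Type*} [CircularPreorder α] {s : Set α} (hs : s.Finite)
    (hne : s.Nonempty) (x : α) : ∃ y ∈ s, ∀ z ∈ s, ¬ sbtw y z x := by
  have : IsStrictOrder α fun z y ↦ sbtw y z x :=
    { irrefl := fun _ ↦ sbtw_irrefl_left
      trans := fun _ _ _ h₁ h₂ ↦ h₂.trans_left h₁ }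
  have := hne.to_subtype
  obtain ⟨y, -, hy⟩ := (hs.wellFoundedOn (r := fun z y ↦ sbtw y z x)).has_min Set.univ
    Set.univ_nonempty
  exact ⟨y, y.2, fun z hz ↦ hy ⟨z, hz⟩ trivial⟩

variable {A : Set ℚ}

/-- The position of a point on the boundary circle, cut open at `-∞`. -/
def Pt.key : Pt A → ℕ ×ₗ ℚ
  | .negInf => toLex (0, 0)
  | .lower i => toLex (1, (i : ℚ))
  | .posInf => toLex (2, 0)
  | .upper q => toLex (3, -(q : ℚ))

theorem Pt.key_injective : Function.Injective (Pt.key (A := A)) := by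
  intro x y h
  cases x <;> cases y <;> simp_all [Pt.key, Subtype.ext_iff]

noncomputable instance : LinearOrder (Pt A) := LinearOrder.lift' Pt.key Pt.key_injective

noncomputable instance : CircularOrder (Pt A) := LinearOrder.toCircularOrder (Pt A)

theorem sbtw_iff_lt {x y z : Pt A} :
    sbtw x y z ↔ x < y ∧ y < z ∨ y < z ∧ z < x ∨ z < x ∧ x < y := Iff.rfl

theorem mem_Ioo_or_sbtw {x y z : Pt A} (hxy : x < y) (hxz : x ≠ z) (hyz : y ≠ z) :
    z ∈ Set.Ioo x y ∨ sbtw y z x := by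
  rw [Set.mem_Ioo, sbtw_iff_lt]
  grind

theorem before_iff_lt {x y : Pt A} : x.Before y ↔ x < y := by
  change _ ↔ x.key < y.key
  cases x <;> cases y <;> simp [Pt.key, Pt.Before, Prod.Lex.toLex_lt_toLex]

@[simp]
theorem lower_lt_lower {k l : ℤ} : (.lower k : Pt A) < .lower l ↔ k < l := by
  rw [← before_iff_lt, Pt.Before]

@[simp]
theorem lower_le_lower {k l : ℤ} : (.lower k : Pt A) ≤ .lower l ↔ k ≤ l := by
  rw [← not_lt, lower_lt_lower, not_lt]

theorem exists_eq_lower {k l : ℤ} {x : Pt A} (hx : x ∈ Set.Icc (.lower k) (.lower l)) :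
    ∃ m ∈ Set.Icc k l, x = .lower m := by
  obtain ⟨hkx, hxl⟩ := hx
  cases x with
  | lower m => exact ⟨m, ⟨lower_le_lower.1 hkx, lower_le_lower.1 hxl⟩, rfl⟩
  | _ => simp [← not_lt, ← before_iff_lt, Pt.Before] at hkx hxl

theorem crosses_comm {e f : Sym2 (Pt A)} : Crosses e f ↔ Crosses f e := by
  simp only [Crosses, or_comm, and_comm]

theorem crosses_iff_sbtw {x y : Pt A} {e : Sym2 (Pt A)} :
    Crosses s(x, y) e ↔ ∃ u v, e = s(u, v) ∧ sbtw x u y ∧ sbtw y v x := by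
  simp only [Crosses, before_iff_lt, sbtw_iff_lt]
  constructor
  · rintro ⟨a, b, c, d, hab, hbc, hcd, ⟨h, rfl⟩ | ⟨h, rfl⟩⟩ <;>
      rcases Sym2.eq_iff.1 h with ⟨rfl, rfl⟩ | ⟨rfl, rfl⟩
    · exact ⟨b, d, rfl, by grind⟩
    · exact ⟨d, b, Sym2.eq_swap, by grind⟩
    · exact ⟨c, a, Sym2.eq_swap, by grind⟩
    · exact ⟨a, c, rfl, by grind⟩
  · rintro ⟨u, v, rfl, hu, hv⟩
    have hrot : x < u ∧ u < y ∧ y < v ∨ u < y ∧ y < v ∧ v < x ∨ y < v ∧ v < x ∧ x < u ∨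
        v < x ∧ x < u ∧ u < y := by
      grind
    rcases hrot with ⟨h₁, h₂, h₃⟩ | ⟨h₁, h₂, h₃⟩ | ⟨h₁, h₂, h₃⟩ | ⟨h₁, h₂, h₃⟩
    · exact ⟨x, u, y, v, h₁, h₂, h₃, .inl ⟨rfl, rfl⟩⟩
    · exact ⟨u, y, v, x, h₁, h₂, h₃, .inr ⟨Sym2.eq_swap, rfl⟩⟩
    · exact ⟨y, v, x, u, h₁, h₂, h₃, .inl ⟨Sym2.eq_swap, Sym2.eq_swap⟩⟩
    · exact ⟨v, x, u, y, h₁, h₂, h₃, .inr ⟨rfl, Sym2.eq_swap⟩⟩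

theorem IsBoundarySegment.not_mem_Ioo {x y z : Pt A} (h : IsBoundarySegment s(x, z)) :
    y ∉ Set.Ioo x z := by
  rintro ⟨hxy, hyz⟩
  rw [← before_iff_lt] at hxy hyz
  rcases h with ⟨i, h⟩ | ⟨p, q, hpq, hr, h⟩
  · rcases Sym2.eq_iff.1 h with ⟨rfl, rfl⟩ | ⟨rfl, rfl⟩ <;> cases y <;>
      simp only [Pt.Before] at hxy hyz <;> lia
  · rcases Sym2.eq_iff.1 h with ⟨rfl, rfl⟩ | ⟨rfl, rfl⟩ <;> cases y <;>
      simp only [Pt.Before] at hxy hyz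
    · exact (hxy.trans hpq).asymm hyz
    · exact hr _ (Subtype.property _) ⟨hyz, hxy⟩

/-! ### Sides and triangles -/

theorem IsBoundarySegment.not_sbtw {a b c d : Pt A} (h : IsBoundarySegment s(a, c))
    (hb : sbtw a b c) : ¬ sbtw c d a := by
  intro hd
  have hac := h.not_mem_Ioo (y := b)
  have hac' := h.not_mem_Ioo (y := d)
  rw [Sym2.eq_swap] at h
  have hca := h.not_mem_Ioo (y := b)
  have hca' := h.not_mem_Ioo (y := d)
  simp only [sbtw_iff_lt, Set.mem_Ioo] at *
  grind

/-- The graph on the marked points whose edges are the arcs of `T` and the boundary segments, so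
that the triangles of `T` are its 3-cliques. -/
def sideGraph (T : Set (Sym2 (Pt A))) : SimpleGraph (Pt A) :=
  .fromEdgeSet (T ∪ {e | IsBoundarySegment e})

variable {T : Set (Sym2 (Pt A))}

theorem sideGraph_adj {x y : Pt A} :
    (sideGraph T).Adj x y ↔ (s(x, y) ∈ T ∨ IsBoundarySegment s(x, y)) ∧ x ≠ y :=
  SimpleGraph.fromEdgeSet_adj _

theorem isTriangle_iff_isNClique {t : Finset (Pt A)} :
    IsTriangle T t ↔ (sideGraph T).IsNClique 3 t := by
  simp only [IsTriangle, SimpleGraph.isNClique_iff, SimpleGraph.IsClique, Set.Pairwise,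
    sideGraph_adj, Finset.mem_coe]
  grind

theorem isTriangle_triple_iff {x y z : Pt A} : IsTriangle T {x, y, z} ↔
    (sideGraph T).Adj x y ∧ (sideGraph T).Adj x z ∧ (sideGraph T).Adj y z := by
  rw [isTriangle_iff_isNClique, SimpleGraph.is3Clique_triple_iff]

theorem IsTriangle.adj {t : Finset (Pt A)} (ht : IsTriangle T t) {x y : Pt A} (hx : x ∈ t)
    (hy : y ∈ t) (hxy : x ≠ y) : (sideGraph T).Adj x y :=
  (isTriangle_iff_isNClique.1 ht).isClique hx hy hxy

theorem IsTriangle.exists_eq_triple {t : Finset (Pt A)} (ht : IsTriangle T t) {x y : Pt A}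
    (hx : x ∈ t) (hy : y ∈ t) (hxy : x ≠ y) : ∃ z, t = {x, y, z} := by
  have hy' : y ∈ t.erase x := Finset.mem_erase.2 ⟨hxy.symm, hy⟩
  have hcard : ((t.erase x).erase y).card = 1 := by
    rw [Finset.card_erase_of_mem hy', Finset.card_erase_of_mem hx, ht.1]
  obtain ⟨z, hz⟩ := Finset.card_eq_one.1 hcard
  exact ⟨z, by rw [← hz, Finset.insert_erase hy', Finset.insert_erase hx]⟩

theorem adj_succ (k : ℤ) : (sideGraph T).Adj (.lower k) (.lower (k + 1)) :=
  sideGraph_adj.2 ⟨.inr (.inl ⟨k, rfl⟩), by simp⟩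

theorem adj_pred (k : ℤ) : (sideGraph T).Adj (.lower k) (.lower (k - 1)) := by
  simpa using (adj_succ (T := T) (k - 1)).symm

theorem not_sbtw_of_adj (hT : IsCompatibleCollection T) {a b c d : Pt A}
    (hac : (sideGraph T).Adj a c) (hbd : (sideGraph T).Adj b d) (hb : sbtw a b c) :
    ¬ sbtw c d a := by
  intro hd
  obtain ⟨hac | hac, -⟩ := sideGraph_adj.1 hac
  · obtain ⟨hbd | hbd, -⟩ := sideGraph_adj.1 hbd
    · refine hT.2 hac hbd ?_ (crosses_iff_sbtw.2 ⟨b, d, rfl, hb, hd⟩)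
      simp only [sbtw_iff_lt, ne_eq, Sym2.eq_iff] at *
      grind
    · refine hbd.not_sbtw (b := c) (d := a) ?_ ?_ <;> simp only [sbtw_iff_lt] at * <;> grind
  · exact hac.not_sbtw hb hd

theorem adj_of_forall_not_sbtw (hT : IsTriangulation T) {x y : Pt A} (hxy : x ≠ y)
    (h : ∀ u v, (sideGraph T).Adj u v → sbtw x u y → ¬ sbtw y v x) : (sideGraph T).Adj x y := by
  refine sideGraph_adj.2 ⟨or_iff_not_imp_right.2 fun hb ↦ ?_, hxy⟩
  have huncrossed : ∀ e ∈ T, ¬ Crosses s(x, y) e := by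
    intro e he hcross
    obtain ⟨u, v, rfl, hu, hv⟩ := crosses_iff_sbtw.1 hcross
    exact h u v (sideGraph_adj.2 ⟨.inl he, (hT.prop.1 _ he).1⟩) hu hv
  have hcoll : IsCompatibleCollection (insert s(x, y) T) := by
    refine ⟨Set.forall_mem_insert.2 ⟨⟨hxy, hb⟩, hT.prop.1⟩, hT.prop.2.insert fun e he _ ↦ ?_⟩
    exact ⟨huncrossed e he, fun hcross ↦ huncrossed e he (crosses_comm.1 hcross)⟩
  exact hT.le_of_ge hcoll (Set.subset_insert _ _) (Set.mem_insert _ _)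

/-- A side separating `x` from `y` would cross one of the sides that join them to `v`. -/
theorem adj_of_consecutive (hT : IsTriangulation T) {v x y : Pt A} (hvx : (sideGraph T).Adj v x)
    (hvy : (sideGraph T).Adj v y) (hvxy : sbtw v x y)
    (h : ∀ u, (sideGraph T).Adj v u → ¬ sbtw x u y) : (sideGraph T).Adj x y := by
  refine adj_of_forall_not_sbtw hT (fun hxy ↦ ?_) fun u w huw hu hw ↦ ?_
  · exact sbtw_irrefl_right (hxy ▸ hvxy)
  have hvw : v ≠ w := by
    rintro rfl
    exact h u huw.symm hu
  have hcross_x := not_sbtw_of_adj hT.prop hvx huw.symm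
  have hcross_y := not_sbtw_of_adj hT.prop hvy huw
  simp only [sbtw_iff_lt] at *
  grind

/-- Otherwise one of the sides ending at `z` would cross one of those ending at `z'`. -/
theorem apex_unique (hT : IsCompatibleCollection T) {x y z z' : Pt A}
    (hxz : (sideGraph T).Adj x z) (hzy : (sideGraph T).Adj z y) (hxz' : (sideGraph T).Adj x z')
    (hzy' : (sideGraph T).Adj z' y) (h : sbtw x z y) (h' : sbtw x z' y) : z = z' := by
  have hcross := not_sbtw_of_adj hT hxz' hzy
  have hcross' := not_sbtw_of_adj hT hxz hzy'
  simp only [sbtw_iff_lt] at *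
  grind

theorem mem_Icc_of_adj (hT : IsCompatibleCollection T) {x y m z : Pt A}
    (hxy : (sideGraph T).Adj x y) (hm : m ∈ Set.Ioo x y) (hmz : (sideGraph T).Adj m z) :
    z ∈ Set.Icc x y := by
  have hcross := not_sbtw_of_adj hT hxy hmz
  simp only [sbtw_iff_lt, Set.mem_Ioo, Set.mem_Icc] at *
  grind

theorem IsTriangle.subset_Icc (hT : IsCompatibleCollection T) {t : Finset (Pt A)}
    (ht : IsTriangle T t) {x y m : Pt A} (hxy : (sideGraph T).Adj x y) (hm : m ∈ Set.Ioo x y)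
    (hmt : m ∈ t) : (t : Set (Pt A)) ⊆ Set.Icc x y := by
  intro z hz
  obtain rfl | hmz := eq_or_ne m z
  · exact Set.Ioo_subset_Icc_self hm
  · exact mem_Icc_of_adj hT hxy hm (ht.adj hmt hz hmz)

theorem finite_neighborSet_lower (hT : IsAdmissibleTriangulation T) (k : ℤ) :
    ((sideGraph T).neighborSet (.lower k)).Finite := by
  have harcs : {x : Pt A | s(Pt.lower k, x) ∈ T}.Finite := by
    refine .of_injOn (f := fun x ↦ s(Pt.lower k, x)) (fun x hx ↦ ?_)
      (fun _ _ _ _ hxy ↦ Sym2.congr_right.1 hxy) (hT.2 k)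
    exact ⟨hx, Sym2.mem_mk_left _ _⟩
  refine (harcs.union (Set.toFinite {.lower (k - 1), .lower (k + 1)})).subset ?_
  intro x hx
  obtain ⟨hx | ⟨i, hi⟩ | ⟨p, q, -, -, hpq⟩, -⟩ := sideGraph_adj.1 hx
  · exact .inl hx
  · rcases Sym2.eq_iff.1 hi with ⟨hki, rfl⟩ | ⟨hki, rfl⟩ <;> obtain rfl := Pt.lower.inj hki <;> simp
  · simp at hpq

theorem finite_trianglesAt (hT : IsAdmissibleTriangulation T) (k : ℤ) :
    (trianglesAt T k).Finite := by
  have hfin := (finite_neighborSet_lower hT k).insert (.lower k)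
  refine hfin.toFinset.powerset.finite_toSet.subset fun t ⟨ht, hk⟩ ↦ ?_
  rw [Finset.mem_coe, Finset.mem_powerset]
  intro x hx
  rw [Set.Finite.mem_toFinset]
  exact or_iff_not_imp_left.2 fun hxk ↦ ht.adj hk hx (Ne.symm hxk)

theorem exists_apex (hT : IsAdmissibleTriangulation T) {k : ℤ} {u x : Pt A}
    (hx : (sideGraph T).Adj (.lower k) x) (hu : (sideGraph T).Adj (.lower k) u)
    (hux : sbtw (.lower k) u x) :
    ∃ y, sbtw (.lower k) y x ∧ (sideGraph T).Adj (.lower k) y ∧ (sideGraph T).Adj y x := by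
  obtain ⟨y, ⟨hy, hyx⟩, hlast⟩ := exists_last_of_finite
    ((finite_neighborSet_lower hT k).inter_of_left (Set.cIoo (.lower k) x)) ⟨u, hu, hux⟩ x
  refine ⟨y, hyx, hy, adj_of_consecutive hT.1 hy hx hyx fun v hv hvx ↦ ?_⟩
  exact hlast v ⟨hv, hyx.trans_left hvx⟩ hvx

theorem exists_apex_inside (hT : IsAdmissibleTriangulation T) {k l : ℤ} (hkl : k + 1 < l)
    (hadj : (sideGraph T).Adj (.lower k) (.lower l)) :
    ∃ m, k < m ∧ m < l ∧ (sideGraph T).Adj (.lower k) (.lower m) ∧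
      (sideGraph T).Adj (.lower m) (.lower l) := by
  have hlt : (.lower k : Pt A) < .lower l := lower_lt_lower.2 (by lia)
  obtain ⟨y, hy, hky, hyl⟩ := exists_apex hT hadj (adj_succ k) (.inl (by simpa))
  have hy : .lower k < y ∧ y < .lower l := by
    rw [sbtw_iff_lt] at hy
    grind
  obtain ⟨m, -, rfl⟩ := exists_eq_lower ⟨hy.1.le, hy.2.le⟩
  exact ⟨m, lower_lt_lower.1 hy.1, lower_lt_lower.1 hy.2, hky, hyl⟩

theorem exists_apex_outside (hT : IsAdmissibleTriangulation T) {k l : ℤ} (hkl : k < l)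
    (hadj : (sideGraph T).Adj (.lower k) (.lower l)) :
    ∃ y, sbtw (.lower l) y (.lower k) ∧ (sideGraph T).Adj (.lower l) y ∧
      (sideGraph T).Adj y (.lower k) :=
  exists_apex hT hadj.symm (adj_succ l) (.inr (.inr (by simpa)))

theorem exists_middle_triangle (hT : IsAdmissibleTriangulation T) (k : ℤ) :
    ∃ x z, x < .lower k ∧ .lower k < z ∧ IsTriangle T {x, .lower k, z} := by
  obtain ⟨x, hkx, hmin⟩ :=
    Set.exists_min_image _ id (finite_neighborSet_lower hT k) ⟨_, adj_pred k⟩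
  have hxk : x < .lower k := (hmin _ (adj_pred k)).trans_lt (by simp)
  obtain ⟨z, hz, hkz, hzx⟩ := exists_apex hT hkx (adj_succ k) (.inr (.inr ⟨hxk, by simp⟩))
  have hkz' : .lower k < z := by
    have hxz : x ≤ z := hmin z hkz
    rw [sbtw_iff_lt] at hz
    grind
  exact ⟨x, z, hxk, hkz', isTriangle_triple_iff.2 ⟨hkx.symm, hzx.symm, hkz⟩⟩

/-! ### Matchings -/

/-- The triangles all of whose corners lie between `x` and `y`. If `x` and `y` are lower vertices
joined by an arc, these are the triangles cut off by this arc. -/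
def trianglesBelow (T : Set (Sym2 (Pt A))) (x y : Pt A) : Set (Finset (Pt A)) :=
  {t | IsTriangle T t ∧ (t : Set (Pt A)) ⊆ Set.Icc x y}

theorem trianglesBelow_subset_of_apex (hT : IsCompatibleCollection T) {x m y : Pt A}
    (hxm : (sideGraph T).Adj x m) (hmy : (sideGraph T).Adj m y) : trianglesBelow T x y ⊆
      trianglesBelow T x m ∪ trianglesBelow T m y ∪ {{x, m, y}} := by
  rintro t ⟨ht, hsub⟩
  by_cases hleft : ∃ v ∈ t, v ∈ Set.Ioo x m
  · obtain ⟨v, hvt, hv⟩ := hleft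
    exact .inl (.inl ⟨ht, ht.subset_Icc hT hxm hv hvt⟩)
  by_cases hright : ∃ v ∈ t, v ∈ Set.Ioo m y
  · obtain ⟨v, hvt, hv⟩ := hright
    exact .inl (.inr ⟨ht, ht.subset_Icc hT hmy hv hvt⟩)
  refine .inr (Finset.eq_of_subset_of_card_le (fun v hv ↦ ?_) (ht.1 ▸ Finset.card_le_three))
  have hvxy := hsub hv
  have hvxm : v ∉ Set.Ioo x m := fun h ↦ hleft ⟨v, hv, h⟩
  have hvmy : v ∉ Set.Ioo m y := fun h ↦ hright ⟨v, hv, h⟩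
  simp only [Finset.mem_insert, Finset.mem_singleton]
  grind

theorem encard_trianglesBelow_le (hT : IsAdmissibleTriangulation T) {n : ℕ} {k l : ℤ}
    (hkl : k + 1 + n = l) (hadj : (sideGraph T).Adj (.lower k) (.lower l)) :
    (trianglesBelow T (.lower k) (.lower l)).encard ≤ n := by
  induction n using Nat.strong_induction_on generalizing k l with
  | _ n ih =>
    rcases n.eq_zero_or_pos with rfl | hn
    · rw [Nat.cast_zero, nonpos_iff_eq_zero, Set.encard_eq_zero]
      refine Set.eq_empty_of_forall_notMem fun t ⟨ht, hsub⟩ ↦ ?_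
      have ht' : t ⊆ {.lower k, .lower l} := by
        intro x hx
        obtain ⟨m, ⟨hkm, hml⟩, rfl⟩ := exists_eq_lower (hsub hx)
        rcases (by lia : m = k ∨ m = l) with rfl | rfl <;> simp
      have hcard := (Finset.card_le_card ht').trans Finset.card_le_two
      simp [ht.1] at hcard
    · obtain ⟨m, hkm, hml, hadjkm, hadjml⟩ := exists_apex_inside hT (by lia) hadj
      obtain ⟨p, hp⟩ := Int.le.dest hkm
      obtain ⟨q, hq⟩ := Int.le.dest hml
      calc (trianglesBelow T (.lower k) (.lower l)).encard
          ≤ (trianglesBelow T (.lower k) (.lower m)).encard +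
              (trianglesBelow T (.lower m) (.lower l)).encard + 1 := by
            refine (Set.encard_le_encard
              (trianglesBelow_subset_of_apex hT.1.prop hadjkm hadjml)).trans ?_
            refine (Set.encard_union_le _ _).trans (add_le_add (Set.encard_union_le _ _) ?_)
            rw [Set.encard_singleton]
        _ ≤ p + q + 1 := by
            gcongr
            · exact ih p (by lia) hp hadjkm
            · exact ih q (by lia) hq hadjml
        _ = n := by
            exact_mod_cast (by lia : p + q + 1 = n)

section Matchings

variable {i j : ℤ} {f : Set.Icc i j → Finset (Pt A)}

/-- An arc cuts off exactly as many triangles as there are vertices strictly below it, and the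
matching assigns all of them to these vertices. -/
theorem apply_notMem_trianglesBelow (hT : IsAdmissibleTriangulation T) (hf : f ∈ matchings T i j)
    {k l : Set.Icc i j} (hkl : k < l) (hadj : (sideGraph T).Adj (.lower k) (.lower l)) :
    f k ∉ trianglesBelow T (.lower k) (.lower l) := by
  intro hk
  obtain ⟨n, hn⟩ := Int.le.dest (show (k : ℤ) + 1 ≤ l from hkl)
  let g : Fin (n + 1) → Set.Icc i j := fun p ↦ ⟨k + p, by grind⟩
  have hg : Function.Injective (f ∘ g) := hf.1.comp fun p q hpq ↦ by
    simpa [g, Fin.ext_iff] using hpq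
  have hrange : Set.range (f ∘ g) ⊆ trianglesBelow T (.lower k) (.lower l) := by
    rintro _ ⟨p, rfl⟩
    obtain hp | hp := eq_or_ne (g p) k
    · rwa [Function.comp_apply, hp]
    · refine ⟨(hf.2 (g p)).1, (hf.2 (g p)).1.subset_Icc hT.1.prop hadj ?_ (hf.2 (g p)).2⟩
      simp only [Set.mem_Ioo, lower_lt_lower]
      grind
  have hcard := (hg.encard_range.trans (Set.encard_le_encard hrange)).trans
    (encard_trianglesBelow_le hT hn hadj)
  rw [ENat.card_eq_coe_fintype_card, Fintype.card_fin, Nat.cast_le] at hcard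
  lia

theorem le_of_lower_mem_apply (hT : IsAdmissibleTriangulation T) (hf : f ∈ matchings T i j)
    {p q l : Set.Icc i j} (hpq : p < q) (hq : .lower (q : ℤ) ∈ f p)
    (hadj : (sideGraph T).Adj (.lower p) (.lower l)) : l ≤ q := by
  by_contra! hql
  refine apply_notMem_trianglesBelow hT hf (hpq.trans hql) hadj ⟨(hf.2 p).1, ?_⟩
  exact (hf.2 p).1.subset_Icc hT.1.prop hadj (m := .lower q) (by simpa using ⟨hpq, hql⟩) hq

theorem apply_eq_triple (hT : IsAdmissibleTriangulation T) (hf : f ∈ matchings T i j)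
    {p q : Set.Icc i j} (hpq : p < q) (hq : .lower (q : ℤ) ∈ f p) :
    ∃ y, sbtw (.lower q) y (.lower p) ∧ f p = {.lower (p : ℤ), .lower (q : ℤ), y} := by
  obtain ⟨ht, hp⟩ := hf.2 p
  have hlt : (.lower p : Pt A) < .lower q := lower_lt_lower.2 hpq
  have hadj := ht.adj hp hq hlt.ne
  have hnot := apply_notMem_trianglesBelow hT hf hpq hadj
  obtain ⟨y, hy⟩ := ht.exists_eq_triple hp hq hlt.ne
  have hyp : y ∈ f p := by simp [hy]
  obtain ⟨-, hpy, hqy⟩ := isTriangle_triple_iff.1 (hy ▸ ht)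
  refine ⟨y, (mem_Ioo_or_sbtw hlt hpy.ne hqy.ne).resolve_left fun hm ↦ ?_, hy⟩
  exact hnot ⟨ht, ht.subset_Icc hT.1.prop hadj hm hyp⟩

/-- If `p` is the least vertex moved by `σ`, then the triangles `f p` and `f (σ p)` both turn out to
lie above the side that joins `p` to `σ p`, so they agree. -/
theorem perm_eq_one_of_mem_matchings (hT : IsAdmissibleTriangulation T) (hf : f ∈ matchings T i j)
    {σ : Equiv.Perm (Set.Icc i j)} (hσ : f ∘ σ ∈ matchings T i j) : σ = 1 := by
  by_contra hne
  obtain ⟨p, hp, hmin⟩ := Set.exists_min_image {k | σ k ≠ k} id (Set.toFinite _)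
    (not_forall.1 fun h ↦ hne (Equiv.ext h))
  have hlt : ∀ {q}, q ≠ p → σ q ≠ q → p < q := fun hqp hq ↦ (hmin _ hq).lt_of_ne' hqp
  have hpq : p < σ p := hlt hp (σ.injective.ne hp)
  obtain ⟨q, hq⟩ := σ.surjective p
  have hqp : q ≠ p := by
    rintro rfl
    exact hp hq
  have hpq' : p < q := hlt hqp (hq ▸ hqp.symm)
  have hfp : .lower (q : ℤ) ∈ f p := hq ▸ (hσ.2 q).2
  have hgp : .lower (σ p : ℤ) ∈ (f ∘ σ) p := (hf.2 (σ p)).2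
  have hadj : (sideGraph T).Adj (.lower p) (.lower q) :=
    (hf.2 p).1.adj (hf.2 p).2 hfp (by simpa [Subtype.ext_iff] using hpq'.ne)
  have hadj' : (sideGraph T).Adj (.lower p) (.lower (σ p)) :=
    (hσ.2 p).1.adj (hσ.2 p).2 hgp (by simpa [Subtype.ext_iff] using hpq.ne)
  obtain rfl : q = σ p := le_antisymm (le_of_lower_mem_apply hT hσ hpq hgp hadj)
    (le_of_lower_mem_apply hT hf hpq' hfp hadj')
  obtain ⟨y, hy, hfp⟩ := apply_eq_triple hT hf hpq hfp
  obtain ⟨z, hz, hgp⟩ := apply_eq_triple hT hσ hpq hgp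
  have hty := hfp ▸ (hf.2 p).1
  have htz := hgp ▸ (hσ.2 p).1
  rw [isTriangle_triple_iff] at hty htz
  obtain rfl := apex_unique hT.1.prop hty.2.2 hty.2.1.symm htz.2.2 htz.2.1.symm hy hz
  exact hp (hf.1 (hgp.trans hfp.symm))

end Matchings

/-! ### The signed incidence matrix -/

/-- The entry of the signed incidence matrix in row `(k, 0)` and column `t`: zero unless `(k, 0)` is
a corner of `t`, and then `-1` for the middle one of the three corners, `1` for the other two. With
these signs, the entries of two lower vertices are opposite in a triangle above the side that joins
them and equal in a triangle below it. -/
noncomputable def cornerSign (k : ℤ) (t : Finset (Pt A)) : ℤ :=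
  if .lower k ∈ t then if ∃ x ∈ t, ∃ z ∈ t, x < .lower k ∧ .lower k < z then -1 else 1 else 0

theorem cornerSign_of_notMem {k : ℤ} {t : Finset (Pt A)} (hk : .lower k ∉ t) :
    cornerSign k t = 0 :=
  if_neg hk

theorem cornerSign_mul_self {k : ℤ} {t : Finset (Pt A)} (hk : .lower k ∈ t) :
    cornerSign k t * cornerSign k t = 1 := by
  rw [cornerSign, if_pos hk]
  split_ifs <;> norm_num

theorem cornerSign_mul_of_outside {k l : ℤ} {y : Pt A} (hkl : k < l)
    (hy : sbtw (.lower l) y (.lower k)) :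
    cornerSign k {.lower k, .lower l, y} * cornerSign l {.lower k, .lower l, y} = -1 := by
  have hlt : (.lower k : Pt A) < .lower l := lower_lt_lower.2 hkl
  rw [sbtw_iff_lt] at hy
  simp only [cornerSign, Finset.mem_insert, Finset.mem_singleton, exists_eq_or_imp,
    exists_eq_left]
  grind

theorem cornerSign_mul_of_inside {k l : ℤ} {y : Pt A} (hy : y ∈ Set.Ioo (.lower k) (.lower l)) :
    cornerSign k {.lower k, .lower l, y} * cornerSign l {.lower k, .lower l, y} = 1 := by
  obtain ⟨hky, hyl⟩ := hy
  simp only [cornerSign, Finset.mem_insert, Finset.mem_singleton, exists_eq_or_imp,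
    exists_eq_left]
  grind

theorem mem_trianglesAt_inter_iff {k l : ℤ} (hkl : k < l) {t : Finset (Pt A)} :
    t ∈ trianglesAt T k ∩ trianglesAt T l ↔ ∃ y, t = {.lower k, .lower l, y} ∧
      (sideGraph T).Adj (.lower k) (.lower l) ∧ (sideGraph T).Adj (.lower k) y ∧
      (sideGraph T).Adj (.lower l) y := by
  constructor
  · rintro ⟨⟨ht, hk⟩, -, hl⟩
    obtain ⟨y, rfl⟩ := ht.exists_eq_triple hk hl (lower_lt_lower.2 hkl).ne
    exact ⟨y, rfl, isTriangle_triple_iff.1 ht⟩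
  · rintro ⟨y, rfl, hadj⟩
    exact ⟨⟨isTriangle_triple_iff.2 hadj, by simp⟩, isTriangle_triple_iff.2 hadj, by simp⟩

theorem trianglesAt_inter_of_not_adj {k l : ℤ} (hkl : k < l)
    (hadj : ¬ (sideGraph T).Adj (.lower k) (.lower l)) : trianglesAt T k ∩ trianglesAt T l = ∅ := by
  ext t
  simp [mem_trianglesAt_inter_iff hkl, hadj]

theorem trianglesAt_inter_succ (hT : IsAdmissibleTriangulation T) (k : ℤ) :
    ∃ y, sbtw (.lower (k + 1)) y (.lower k) ∧
      trianglesAt T k ∩ trianglesAt T (k + 1) = {{.lower k, .lower (k + 1), y}} := by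
  obtain ⟨y, hy, hly, hyk⟩ := exists_apex_outside hT (lt_add_one k) (adj_succ k)
  refine ⟨y, hy, Set.ext fun t ↦ ?_⟩
  rw [mem_trianglesAt_inter_iff (lt_add_one k), Set.mem_singleton_iff]
  constructor
  · rintro ⟨z, rfl, -, hkz, hlz⟩
    have hz : sbtw (.lower (k + 1)) z (.lower k) :=
      (mem_Ioo_or_sbtw (by simp) hkz.ne hlz.ne).resolve_left
        (IsBoundarySegment.not_mem_Ioo (.inl ⟨k, rfl⟩))
    rw [apex_unique hT.1.prop hlz hkz.symm hly hyk hz hy]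
  · rintro rfl
    exact ⟨y, rfl, adj_succ k, hyk.symm, hly⟩

theorem trianglesAt_inter_of_adj (hT : IsAdmissibleTriangulation T) {k l : ℤ} (hkl : k + 1 < l)
    (hadj : (sideGraph T).Adj (.lower k) (.lower l)) :
    ∃ y m, sbtw (.lower l) y (.lower k) ∧ m ∈ Set.Ioo (.lower k) (.lower l) ∧
      trianglesAt T k ∩ trianglesAt T l =
        {{.lower k, .lower l, y}, {.lower k, .lower l, m}} := by
  have hlt : k < l := by lia
  obtain ⟨y, hy, hly, hyk⟩ := exists_apex_outside hT hlt hadj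
  obtain ⟨m, hkm, hml, hadjkm, hadjml⟩ := exists_apex_inside hT hkl hadj
  have hm : .lower m ∈ Set.Ioo (.lower k : Pt A) (.lower l) := by simp [hkm, hml]
  refine ⟨y, .lower m, hy, hm, Set.ext fun t ↦ ?_⟩
  rw [mem_trianglesAt_inter_iff hlt]
  constructor
  · rintro ⟨z, rfl, -, hkz, hlz⟩
    rcases mem_Ioo_or_sbtw (lower_lt_lower.2 hlt) hkz.ne hlz.ne with hz | hz
    · rw [apex_unique hT.1.prop hkz hlz.symm hadjkm hadjml (.inl hz) (.inl hm)]
      exact .inr rfl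
    · rw [apex_unique hT.1.prop hlz hkz.symm hly hyk hz hy]
      exact .inl rfl
  · rintro (rfl | rfl)
    · exact ⟨y, rfl, hadj, hyk.symm, hly⟩
    · exact ⟨.lower m, rfl, hadj, hadjkm, hadjml.symm⟩

theorem finsum_cornerSign_mul_cornerSign (hT : IsAdmissibleTriangulation T) {k l : ℤ}
    (hkl : k < l) : ∑ᶠ t ∈ trianglesAt T k ∩ trianglesAt T l, cornerSign k t * cornerSign l t =
      if k + 1 = l then -1 else 0 := by
  split_ifs with hl
  · subst hl
    obtain ⟨y, hy, hinter⟩ := trianglesAt_inter_succ hT k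
    rw [hinter, finsum_mem_singleton, cornerSign_mul_of_outside hkl hy]
  · by_cases hadj : (sideGraph T).Adj (.lower k) (.lower l)
    · obtain ⟨y, m, hy, hm, hinter⟩ := trianglesAt_inter_of_adj hT (by lia) hadj
      have hsign := cornerSign_mul_of_outside hkl hy
      have hsign' := cornerSign_mul_of_inside hm
      rw [hinter, finsum_mem_pair, hsign, hsign', neg_add_cancel]
      intro heq
      rw [heq, hsign'] at hsign
      norm_num at hsign
    · rw [trianglesAt_inter_of_not_adj hkl hadj, finsum_mem_empty]

theorem sum_trianglesAt_eq_finsum_inter (hT : IsAdmissibleTriangulation T) (k l : ℤ) :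
    ∑ t ∈ (finite_trianglesAt hT k).toFinset, cornerSign k t * cornerSign l t =
      ∑ᶠ t ∈ trianglesAt T k ∩ trianglesAt T l, cornerSign k t * cornerSign l t := by
  rw [← finsum_mem_coe_finset, Set.Finite.coe_toFinset]
  refine finsum_mem_inter_support_eq' _ _ _ fun t ht ↦ ⟨fun hk ↦ ⟨hk, hk.1, ?_⟩, And.left⟩
  by_contra hl
  exact ht (mul_eq_zero_of_right _ (cornerSign_of_notMem hl))

theorem sum_cornerSign_mul_cornerSign (hT : IsAdmissibleTriangulation T) (k l : ℤ) :
    ∑ t ∈ (finite_trianglesAt hT k).toFinset, cornerSign k t * cornerSign l t =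
      if k = l then ((trianglesAt T k).ncard : ℤ) else if k + 1 = l ∨ l + 1 = k then -1 else 0 := by
  rcases lt_trichotomy k l with hkl | rfl | hkl
  · rw [sum_trianglesAt_eq_finsum_inter hT, finsum_cornerSign_mul_cornerSign hT hkl]
    grind
  · rw [if_pos rfl, Set.ncard_eq_toFinset_card _ (finite_trianglesAt hT k),
      Finset.sum_eq_card_nsmul fun t ht ↦
        cornerSign_mul_self ((finite_trianglesAt hT k).mem_toFinset.1 ht).2, nsmul_one]
  · rw [sum_trianglesAt_eq_finsum_inter hT, Set.inter_comm]
    simp only [mul_comm (cornerSign k _), finsum_cornerSign_mul_cornerSign hT hkl]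
    grind

theorem coe_piFinset_filter_injective (hT : IsAdmissibleTriangulation T) (i j : ℤ) :
    (({f ∈ Fintype.piFinset fun k : Set.Icc i j ↦ (finite_trianglesAt hT k).toFinset |
      Function.Injective f} : Finset (Set.Icc i j → Finset (Pt A))) : Set _) = matchings T i j := by
  ext f
  simp [matchings, and_comm]

theorem finite_matchings (hT : IsAdmissibleTriangulation T) (i j : ℤ) :
    (matchings T i j).Finite :=
  coe_piFinset_filter_injective hT i j ▸ Finset.finite_toSet _

theorem det_eq_ncard_matchings (hT : IsAdmissibleTriangulation T) (i j : ℤ) :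
    (Matrix.of fun k l : Set.Icc i j ↦ ∑ t ∈ (finite_trianglesAt hT k).toFinset,
      cornerSign k t * cornerSign l t).det = ((matchings T i j).ncard : ℤ) := by
  rw [det_gram_eq_card_injective (fun k : Set.Icc i j ↦ cornerSign k)
    (fun k ↦ (finite_trianglesAt hT k).toFinset), ← coe_piFinset_filter_injective hT,
    Set.ncard_coe_finset]
  · intro k t ht
    exact cornerSign_mul_self ((finite_trianglesAt hT k).mem_toFinset.1 ht).2
  · intro k l t hk hl
    rw [Set.Finite.mem_toFinset] at hk hl
    exact cornerSign_of_notMem fun h ↦ hl ⟨hk.1, h⟩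
  · intro f hf hmem σ hσ
    simp only [Set.Finite.mem_toFinset] at hmem hσ
    exact perm_eq_one_of_mem_matchings hT ⟨hf, hmem⟩ ⟨hf.comp σ.injective, hσ⟩

/-- The numbering `p ↦ i + p` of `n` consecutive lower vertices by `Fin n`. The upper bound of the
interval is chosen such that `j = i - 1` corresponds to `n = 0`, as in a frieze. -/
def finEquivIcc (i : ℤ) (n : ℕ) : Fin n ≃ Set.Icc i (i - 1 + n) where
  toFun p := ⟨i + p, by grind⟩
  invFun k := ⟨(k - i).toNat, by grind⟩
  left_inv p := by simp
  right_inv k := by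
    ext
    grind

theorem ncard_matchings (hT : IsAdmissibleTriangulation T) (i : ℤ) (n : ℕ) :
    ((matchings T i (i - 1 + n)).ncard : ℤ) =
      continuant (fun k ↦ ((trianglesAt T k).ncard : ℤ)) i n := by
  rw [← det_eq_ncard_matchings hT, ← Matrix.det_submatrix_equiv_self (finEquivIcc i n), continuant]
  congr 1
  ext p q
  simp only [Matrix.submatrix_apply, Matrix.of_apply, sum_cornerSign_mul_cornerSign hT,
    finEquivIcc, Equiv.coe_fn_mk, tridiagonal, Fin.ext_iff]
  grind

theorem matchings_nonempty (hT : IsAdmissibleTriangulation T) (i j : ℤ) :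
    (matchings T i j).Nonempty := by
  choose x z hx hz ht using exists_middle_triangle hT
  have hle (k l : ℤ) (heq : ({x k, .lower k, z k} : Finset (Pt A)) = {x l, .lower l, z l}) :
      l ≤ k := by
    by_contra! hkl
    have hlt : (.lower k : Pt A) < .lower l := lower_lt_lower.2 hkl
    have hl : .lower l ∈ ({x k, .lower k, z k} : Finset (Pt A)) := by simp [heq]
    have hzl : z l ∈ ({x k, .lower k, z k} : Finset (Pt A)) := by simp [heq]
    simp only [Finset.mem_insert, Finset.mem_singleton] at hl hzl
    have := hx k
    have := hz l
    grind
  refine ⟨fun k ↦ {x k, .lower k, z k}, fun k l heq ↦ ?_, fun k ↦ ⟨ht k, by simp⟩⟩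
  exact Subtype.ext (le_antisymm (hle l k heq.symm) (hle k l heq))

end InfiniteStrip

theorem theorem5p6 (A : Set ℚ) (T : Set (Sym2 (InfiniteStrip.Pt A)))
    (hT : InfiniteStrip.IsAdmissibleTriangulation T) :
    (∀ i : ℤ, (InfiniteStrip.trianglesAt T i).Finite) ∧
    (∀ i j : ℤ, i ≤ j → (InfiniteStrip.matchings T i j).Finite) ∧
    (∃ m : ℤ → ℤ → ℤ, InfiniteStrip.IsInfiniteFrieze m ∧
      InfiniteStrip.IsQuiddityRow m (fun i => ((InfiniteStrip.trianglesAt T i).ncard : ℤ))) ∧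
    (∀ m : ℤ → ℤ → ℤ, InfiniteStrip.IsInfiniteFrieze m →
      InfiniteStrip.IsQuiddityRow m (fun i => ((InfiniteStrip.trianglesAt T i).ncard : ℤ)) →
      ∀ i j : ℤ, i ≤ j → m i j = ((InfiniteStrip.matchings T i j).ncard : ℤ)) := by
  refine ⟨InfiniteStrip.finite_trianglesAt hT,
    fun i j _ ↦ InfiniteStrip.finite_matchings hT i j,
    ⟨_, InfiniteStrip.isInfiniteFrieze_continuantArray fun i n ↦ ?_,
      InfiniteStrip.isQuiddityRow_continuantArray _⟩, fun m hm hq i j hij ↦ ?_⟩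
  · rw [← InfiniteStrip.ncard_matchings hT, Nat.cast_pos,
      Set.ncard_pos (InfiniteStrip.finite_matchings hT _ _)]
    exact InfiniteStrip.matchings_nonempty hT _ _
  · obtain ⟨n, rfl⟩ := Int.le.dest (show i - 1 ≤ j by lia)
    rw [hm.eq_continuant hq, InfiniteStrip.ncard_matchings hT]
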